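/- A tree decomposition of a finite graph $\Gamma$ is a tree $T$ together with subsets $B_t\subseteq V(\Gamma)$, $t\in V(T)$, such that every edge of $\Gamma$ is contained in some $B_t$ and, for each $v\in V(\Gamma)$, the set $\{t\in V(T)\mid v\in B_t\}$ is non-empty and induces a connected subgraph of $T$. Its width is $\max\{|B_t|-1\mid t\in V(T)\}$, and the treewidth $\operatorname{tw}(\Gamma)$ is the smallest width of a tree decomposition of $\Gamma$. The independence number $\alpha(\Gamma)$ is the largest size of a set of pairwise non-adjacent vertices. Theorem. Let $q$ be a prime power, let $F_q$ be the field with $q$ elements, and let $\Gamma=K_q(4,2,1)$ be the graph whose vertices are the $2$-dimensional subspaces of $F_q^4$, two vertices $U,W$ being adjacent if and only if $\dim(U\cap W)<1$ (equivalently, the vertices are the lines of $\mathrm{PG}(3,q)$, adjacent if and only if they are skew). Then $$\operatorname{tw}(\Gamma)=|V(\Gamma)|-(q^2+q+2)=|V(\Gamma)|-\alpha(\Gamma)-1 .$$ -/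

import Mathlib

/-- A tree decomposition of a graph `G` over a tree on the vertex set `ι`: a tree together with
a family of bags `bag t ⊆ V(G)`, indexed by the vertices of the tree, such that every edge of `G`
lies in some bag and, for each vertex `v` of `G`, the set of tree vertices whose bag contains `v`
is nonempty and induces a connected subgraph of the tree.
(`SimpleGraph.Connected` includes nonemptiness.) -/
structure TreeDecomposition {V : Type*} (G : SimpleGraph V) (ι : Type*) where
  tree : SimpleGraph ι
  isTree : tree.IsTree
  bag : ι → Set V
  edge_mem_bag : ∀ u v : V, G.Adj u v → ∃ t : ι, u ∈ bag t ∧ v ∈ bag t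
  connected : ∀ v : V, (tree.induce {t : ι | v ∈ bag t}).Connected

namespace TreeDecomposition

/-- The width of a tree decomposition of a finite graph: the maximum of `|bag t| - 1`.
The supremum is a maximum, since the values are bounded by `|V|`. Over a nonempty `V`
some bag is nonempty, so truncating the value `-1` of an empty bag to `0` changes nothing. -/
noncomputable def width {V : Type*} [Finite V] {G : SimpleGraph V} {ι : Type*}
    (D : TreeDecomposition G ι) : ℕ :=
  ⨆ t : ι, ((D.bag t).ncard - 1)

theorem bddAbove_width {V : Type*} [Finite V] {G : SimpleGraph V} {ι : Type*}
    (D : TreeDecomposition G ι) :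
    BddAbove (Set.range fun t : ι => (D.bag t).ncard - 1) := by
  refine ⟨Nat.card V, ?_⟩
  rintro _ ⟨t, rfl⟩
  exact (Nat.sub_le _ _).trans (Set.ncard_le_card (D.bag t))

/-- The trivial tree decomposition: one tree vertex, whose bag is everything. -/
def single {V : Type*} (G : SimpleGraph V) : TreeDecomposition G Unit where
  tree := ⊥
  isTree := SimpleGraph.IsTree.of_subsingleton
  bag := fun _ => Set.univ
  edge_mem_bag := fun _ _ _ => ⟨(), Set.mem_univ _, Set.mem_univ _⟩
  connected := fun v =>
    have : Nonempty ↥{t : Unit | v ∈ (Set.univ : Set V)} := ⟨⟨(), Set.mem_univ v⟩⟩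
    { preconnected := SimpleGraph.Preconnected.of_subsingleton }

end TreeDecomposition

/-- The treewidth of a finite graph: the smallest width of its tree decompositions. -/
noncomputable def treewidth {V : Type*} [Finite V] (G : SimpleGraph V) : ℕ :=
  sInf {w : ℕ | ∃ (ι : Type) (D : TreeDecomposition G ι), D.width = w}

/-- The set of widths in the definition of `treewidth` is nonempty, so that the infimum
is attained. -/
theorem exists_width_eq_treewidth {V : Type*} [Finite V] (G : SimpleGraph V) :
    ∃ (ι : Type) (D : TreeDecomposition G ι), D.width = treewidth G :=
  Nat.sInf_mem (s := {w : ℕ | ∃ (ι : Type) (D : TreeDecomposition G ι), D.width = w})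
    ⟨_, Unit, TreeDecomposition.single G, rfl⟩

/-- The vertices of the `q`-Kneser graph: the `k`-dimensional subspaces of `F ^ n`. -/
abbrev QKneserVertex (F : Type*) [Field F] (n k : ℕ) : Type _ :=
  {U : Submodule F (Fin n → F) // Module.finrank F U = k}

/-- The generalized `q`-Kneser graph `K_q(n,k,t)` over the field `F` with `q` elements: two
distinct `k`-dimensional subspaces `U`, `W` of `F ^ n` are adjacent if and only if
`dim (U ∩ W) < t`. (For `t ≤ k` distinctness follows from the dimension condition.) -/
def qKneserGraph (F : Type*) [Field F] (n k t : ℕ) : SimpleGraph (QKneserVertex F n k) where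
  Adj U W := U ≠ W ∧ Module.finrank F ↥(U.1 ⊓ W.1) < t
  symm := ⟨fun _ _ h => ⟨h.1.symm, by rw [inf_comm]; exact h.2⟩⟩
  loopless := ⟨fun _ h => h.1 rfl⟩

/-!
The upper bound comes from the tree decomposition over a star whose centre is the complement of a
maximum independent set `I` (all lines through a point) and whose leaves are the closed
neighbourhoods of the elements of `I`; see `SimpleGraph.IsIndepSet.treewidth_add_card_add_one_le`.

For the lower bound, it is shown that every tree decomposition has a bag that misses at most
`q² + q + 1` lines. Root the tree, and order the vertices of the graph by the depth of the highest
node whose bag contains them. Let `Z` be a maximal set of deepest vertices that induces a subgraph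
of maximum degree at most one, and let `v` be a deepest vertex outside `Z`. Let `K` be the component
of `v` in the subgraph induced by `Z ∪ {v}`. The bag at the highest node of `v` contains `v` and all
neighbours of `K` outside `K`, so that it misses only elements of `K \ {v}` and lines that meet all
of `K` (`TreeDecomposition.exists_compl_bag_subset_separated`). By the maximality of `Z`, the
component `K` has at least three elements. There are two cases.

If `K \ {v}` contains an edge, then all lines in question, apart from at most two or four of them,
are common transversals of three lines that are not pairwise intersecting, of which there are at
most `2 q + 1` (`ncard_transversals_triple_le`), or of a skew quadrilateral, of which there are at
most two (`ncard_transversals_quadruple_le`).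

Otherwise `K \ {v}` consists of pairwise meeting lines that are skew to `v`
(`ncard_union_transversals_le`). If these do not lie in a plane pencil, then they and all their
common transversals pass through a common point or lie in a common plane, which leaves at most
`q² + q + 1` lines. In a plane pencil there are at most `q` of them, and at most `2 q + 1` common
transversals with `v`.

Since `2 q + 3`, `6` and `3 q + 1` are at most `q² + q + 1` for `q ≥ 2`, the bound follows. The same
dichotomy for pairwise meeting lines gives the independence number.
-/

open Module

/-! ### Descendants in rooted trees -/

namespace SimpleGraph

variable {ι : Type*} {T : SimpleGraph ι}

/-- In a tree rooted at `r`, a vertex `x` has only one neighbour closer to the root. -/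
lemma IsTree.eq_of_adj_of_dist_eq_dist_add_one (hT : T.IsTree) {r x y y' : ι}
    (hy : T.Adj y x) (hy' : T.Adj y' x) (h : T.dist r x = T.dist r y + 1)
    (h' : T.dist r x = T.dist r y' + 1) : y = y' := by
  obtain ⟨p, hp⟩ := hT.connected.exists_walk_length_eq_dist r y
  obtain ⟨p', hp'⟩ := hT.connected.exists_walk_length_eq_dist r y'
  have h1 : (p.concat hy).IsPath := Walk.isPath_of_length_eq_dist _ (by simp; omega)
  have h2 : (p'.concat hy').IsPath := Walk.isPath_of_length_eq_dist _ (by simp; omega)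
  have := hT.isAcyclic.subsingleton_path r x
  have := congrArg (fun q : T.Path r x => q.1.penultimate) (Subsingleton.elim ⟨_, h1⟩ ⟨_, h2⟩)
  simpa using this

/-- `T.Below r t x` says that the vertex `x` of the tree `T` with root `r` is a descendant of `t`
(possibly `t` itself): the vertex `t` lies on the path from `r` to `x`. -/
def Below (T : SimpleGraph ι) (r t x : ι) : Prop :=
  T.dist r x = T.dist r t + T.dist t x

lemma below_self (r t : ι) : T.Below r t t := by simp [Below]

/-- An edge of a rooted tree leaves the set of descendants of `t` only from `t` to its parent. -/
lemma IsTree.eq_and_dist_lt_of_not_below (hT : T.IsTree) {r t x y : ι} (hx : T.Below r t x)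
    (hxy : T.Adj x y) (hy : ¬ T.Below r t y) : x = t ∧ T.dist r y < T.dist r t := by
  have htri := hT.connected.dist_triangle (u := r) (v := t) (w := y)
  unfold Below at hx hy
  have h1 : T.dist x y = 1 := dist_eq_one_iff_adj.2 hxy
  have htri2 := hT.connected.dist_triangle (u := t) (v := x) (w := y)
  rcases hT.dist_eq_dist_add_one_of_adj r hxy with h | h
  · by_cases hxt : x = t
    · subst hxt
      exact ⟨rfl, by omega⟩
    · exfalso
      -- The neighbour of `x` on the path to `t` is also the parent of `x`, that is `y`.
      obtain ⟨p, hp⟩ := hT.connected.exists_walk_length_eq_dist x t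
      cases p with
      | nil => exact hxt rfl
      | @cons _ z _ hxz p' =>
        have hz : T.dist z t ≤ p'.length := dist_le p'
        simp only [Walk.length_cons] at hp
        rw [dist_comm (u := x)] at hp
        rw [dist_comm] at hz
        have h2 := hT.connected.dist_triangle (u := r) (v := t) (w := z)
        have h3 := hT.connected.dist_triangle (u := r) (v := z) (w := x)
        have h4 : T.dist z x = 1 := dist_eq_one_iff_adj.2 hxz.symm
        have : y = z := hT.eq_of_adj_of_dist_eq_dist_add_one (r := r) hxy.symm hxz.symm h
          (by omega)
        subst this
        omega
  · exfalso; omega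

/-- A connected set of vertices of a rooted tree that contains both descendants and
non-descendants of `t` contains `t` and its parent. -/
lemma IsTree.mem_and_exists_dist_lt (hT : T.IsTree) {r t : ι} {A : Set ι}
    (hA : (T.induce A).Connected) {a b : ι} (ha : a ∈ A) (hb : b ∈ A) (hat : T.Below r t a)
    (hbt : ¬ T.Below r t b) : t ∈ A ∧ ∃ y ∈ A, T.dist r y < T.dist r t := by
  obtain ⟨p⟩ := hA.preconnected ⟨a, ha⟩ ⟨b, hb⟩
  obtain ⟨e, -, h1, h2⟩ := p.exists_boundary_dart {x | T.Below r t x} hat hbt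
  obtain ⟨h3, h4⟩ := hT.eq_and_dist_lt_of_not_below h1 (by simpa using e.adj) h2
  exact ⟨h3 ▸ e.fst.2, _, e.snd.2, h4⟩

/-! ### Sets inducing a matching -/

variable {V : Type*}

/-- The set `Z` induces a subgraph of maximum degree at most one. -/
def InducesMatching (G : SimpleGraph V) (Z : Set V) : Prop :=
  ∀ a ∈ Z, ∀ b ∈ Z, ∀ c ∈ Z, G.Adj a b → G.Adj a c → b = c

/-- The vertices of `Z` that can be reached from `v` by a path of length one or two with all its
further vertices in `Z`. When `Z` induces a matching, this is the component of `v` in the subgraph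
induced by `insert v Z`, without `v` itself. -/
def attached (G : SimpleGraph V) (Z : Set V) (v : V) : Set V :=
  {u ∈ Z | G.Adj v u ∨ ∃ w ∈ Z, G.Adj v w ∧ G.Adj w u}

/-- The vertices other than `v` that lie in `G.attached Z v`, or are adjacent neither to `v` nor to
any vertex of `G.attached Z v`. -/
def separated (G : SimpleGraph V) (Z : Set V) (v : V) : Set V :=
  {u | u ≠ v ∧ (u ∈ G.attached Z v ∨ (¬ G.Adj v u ∧ ∀ w ∈ G.attached Z v, ¬ G.Adj w u))}

end SimpleGraph

/-! ### Bags of a tree decomposition -/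

open SimpleGraph

namespace TreeDecomposition

variable {V : Type*} {G : SimpleGraph V} {ι : Type*}

/-- Root the tree of a tree decomposition, and let `τ v` be the node closest to the root whose bag
contains `v`, and `d v` its depth. The relation `B v w` says that all nodes whose bags contain `w`
are descendants of `τ v`. -/
lemma exists_depth (D : TreeDecomposition G ι) :
    ∃ (d : V → ℕ) (τ : V → ι) (B : V → V → Prop), (∀ v, v ∈ D.bag (τ v)) ∧ (∀ v, B v v) ∧
      (∀ v w u, B v w → G.Adj w u → d v ≤ d u → B v u) ∧
      (∀ v w u, B v w → G.Adj w u → d u ≤ d v → u ∈ D.bag (τ v)) := by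
  obtain ⟨r⟩ := D.isTree.connected.nonempty
  have hex (v : V) : ∃ t, v ∈ D.bag t ∧ ∀ x, v ∈ D.bag x → D.tree.dist r t ≤ D.tree.dist r x := by
    obtain ⟨t₀⟩ := (D.connected v).nonempty
    obtain ⟨t, ht, hmin⟩ := (InvImage.wf (D.tree.dist r) Nat.lt_wfRel.wf).has_min
      {t | v ∈ D.bag t} ⟨t₀, t₀.2⟩
    exact ⟨t, ht, fun x hx => not_lt.1 (hmin x hx)⟩
  choose τ hτ hmin using hex
  refine ⟨fun v => D.tree.dist r (τ v), τ, fun v w => ∀ x, w ∈ D.bag x → D.tree.Below r (τ v) x,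
    hτ, fun v x hx => ?_, fun v w u hB hwu hd x hx => ?_, fun v w u hB hwu hd => ?_⟩
  · by_contra h
    obtain ⟨-, y, hy, hlt⟩ := D.isTree.mem_and_exists_dist_lt (D.connected v) (hτ v) hx
      (below_self r _) h
    exact absurd (hmin v y hy) (not_le.2 hlt)
  · by_contra h
    obtain ⟨t, hwt, hut⟩ := D.edge_mem_bag w u hwu
    obtain ⟨-, y, hy, hlt⟩ := D.isTree.mem_and_exists_dist_lt (D.connected u) hut hx (hB t hwt) h
    exact absurd (hd.trans (hmin u y hy)) (not_le.2 hlt)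
  · obtain ⟨t, hwt, hut⟩ := D.edge_mem_bag w u hwu
    by_cases h : D.tree.Below r (τ v) (τ u)
    · -- A descendant of `τ v` of at most the same depth is `τ v` itself.
      have h0 : D.tree.dist (τ v) (τ u) = 0 := by
        have hd' : D.tree.dist r (τ u) ≤ D.tree.dist r (τ v) := hd
        unfold Below at h
        omega
      rw [D.isTree.connected.dist_eq_zero_iff] at h0
      exact h0 ▸ hτ u
    · exact (D.isTree.mem_and_exists_dist_lt (D.connected u) hut (hτ u) (hB t hwt) h).1

/-- Let `Z` be a maximal set of deepest vertices that induces a matching, and let `v` be a deepest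
vertex outside `Z`. The bag at the highest node of `v` contains everything outside
`G.separated Z v`. -/
lemma exists_compl_bag_subset_separated [Finite V] (D : TreeDecomposition G ι)
    (hG : ¬ G.InducesMatching Set.univ) :
    ∃ (Z : Set V) (v : V) (t : ι), v ∉ Z ∧ G.InducesMatching Z ∧
      ¬ G.InducesMatching (insert v Z) ∧ (D.bag t)ᶜ ⊆ G.separated Z v := by
  obtain ⟨d, τ, B, hτ, hBself, hBstep, hBbag⟩ := D.exists_depth
  obtain ⟨Z, ⟨hZ, hdown⟩, hmax⟩ := (Set.toFinite {Z : Set V | G.InducesMatching Z ∧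
    ∀ z ∈ Z, ∀ u ∉ Z, d u ≤ d z}).exists_maximal ⟨∅, by simp [InducesMatching]⟩
  have hne : (Zᶜ).Nonempty := by
    rw [Set.nonempty_compl]
    rintro rfl
    exact hG hZ
  obtain ⟨v, hv, hvmax⟩ := Set.exists_max_image Zᶜ d (Set.toFinite _) hne
  refine ⟨Z, v, τ v, hv, hZ, fun h => ?_, fun u hu => ?_⟩
  · have hmem : insert v Z ∈ {Z : Set V | G.InducesMatching Z ∧
        ∀ z ∈ Z, ∀ u ∉ Z, d u ≤ d z} := by
      refine ⟨h, fun z hz u hu => ?_⟩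
      rw [Set.mem_insert_iff, not_or] at hu
      rcases hz with rfl | hz
      · exact hvmax u hu.2
      · exact hdown z hz u hu.2
    exact hv (hmax hmem (Set.subset_insert v Z) (Set.mem_insert v Z))
  · have hB : ∀ w ∈ G.attached Z v, B v w := by
      rintro w ⟨hw, h | ⟨x, hx, hvx, hxw⟩⟩
      · exact hBstep v v w (hBself v) h (hdown w hw v hv)
      · exact hBstep v x w (hBstep v v x (hBself v) hvx (hdown x hx v hv)) hxw (hdown w hw v hv)
    have huv : u ≠ v := by
      rintro rfl
      exact hu (hτ u)
    refine ⟨huv, ?_⟩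
    by_contra! hcon
    obtain ⟨huK, hadj⟩ := hcon
    by_cases hvu : G.Adj v u
    · by_cases huZ : u ∈ Z
      · exact huK ⟨huZ, .inl hvu⟩
      · exact hu (hBbag v v u (hBself v) hvu (hvmax u huZ))
    · obtain ⟨w, hw, hwu⟩ := hadj hvu
      by_cases huZ : u ∈ Z
      · obtain ⟨hwZ, h | ⟨x, hx, hvx, hxw⟩⟩ := id hw
        · exact huK ⟨huZ, .inr ⟨w, hwZ, h, hwu⟩⟩
        · have := hZ w hwZ x hx u huZ hxw.symm hwu
          exact hvu (this ▸ hvx)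
      · exact hu (hBbag v w u (hB w hw) hwu (hvmax u huZ))

/-- A tree decomposition of small width yields a large set of the form `G.separated Z v`. -/
lemma card_le_width_add [Finite V] (D : TreeDecomposition G ι)
    (hG : ¬ G.InducesMatching Set.univ) {k : ℕ}
    (hk : ∀ (Z : Set V) (v : V), v ∉ Z → G.InducesMatching Z → ¬ G.InducesMatching (insert v Z) →
      (G.separated Z v).ncard ≤ k) :
    Nat.card V ≤ D.width + 1 + k := by
  obtain ⟨Z, v, t, hv, hZ, hZv, hsub⟩ := D.exists_compl_bag_subset_separated hG
  have h1 : (D.bag t)ᶜ.ncard ≤ k := (Set.ncard_le_ncard hsub).trans (hk Z v hv hZ hZv)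
  have h2 := Set.ncard_add_ncard_compl (D.bag t)
  have h3 : (D.bag t).ncard - 1 ≤ D.width := le_ciSup D.bddAbove_width t
  omega

end TreeDecomposition

/-! ### The tree decomposition given by an independent set -/

/-- The tree decomposition used here is the star with centre `Iᶜ` and the closed neighbourhoods of
the elements of `I` as leaves. By `hnon`, its leaves are no larger than the complement of `I`. -/
theorem SimpleGraph.IsIndepSet.treewidth_add_card_add_one_le {V : Type*} [Finite V]
    {G : SimpleGraph V} {I : Finset V} (hI : G.IsIndepSet I) (hIne : I.card < Nat.card V)
    (hnon : ∀ v ∈ I, ∃ u ∉ I, ¬ G.Adj v u) :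
    treewidth G + I.card + 1 ≤ Nat.card V := by
  classical
  let e : Fin I.card ≃ I := I.equivFin.symm
  let D : TreeDecomposition G (Option (Fin I.card)) :=
    { tree := starGraph none
      isTree := isTree_starGraph none
      bag := fun o => o.elim {u | u ∉ I} fun i => {u | u = e i ∨ G.Adj (e i) u}
      edge_mem_bag := by
        intro u v huv
        by_cases hu : u ∈ I
        · exact ⟨some (e.symm ⟨u, hu⟩), by simp, by simp [huv]⟩
        · by_cases hv : v ∈ I
          · exact ⟨some (e.symm ⟨v, hv⟩), by simp [huv.symm], by simp⟩
          · exact ⟨none, hu, hv⟩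
      connected := by
        intro v
        by_cases hv : v ∈ I
        · have hsub : ∀ o : Option (Fin I.card),
              v ∈ (o.elim {u | u ∉ I} fun i => {u | u = e i ∨ G.Adj (e i) u} : Set V) ↔
                o = some (e.symm ⟨v, hv⟩) := by
            rintro (_ | i)
            · simp [hv]
            · simp only [Option.elim_some, Set.mem_ofPred_eq, Option.some.injEq,
                Equiv.eq_symm_apply, Subtype.ext_iff]
              refine ⟨fun h => ?_, fun h => .inl h.symm⟩
              rcases h with h | h
              · exact h.symm
              · exact absurd h (hI (e i).2 hv h.ne)
          have : Nonempty {o : Option (Fin I.card) |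
              v ∈ (o.elim {u | u ∉ I} fun i => {u | u = e i ∨ G.Adj (e i) u} : Set V)} :=
            ⟨⟨_, (hsub _).2 rfl⟩⟩
          have : Subsingleton {o : Option (Fin I.card) |
              v ∈ (o.elim {u | u ∉ I} fun i => {u | u = e i ∨ G.Adj (e i) u} : Set V)} :=
            ⟨fun a b => Subtype.ext (((hsub _).1 a.2).trans ((hsub _).1 b.2).symm)⟩
          exact { preconnected := Preconnected.of_subsingleton }
        · refine Connected.of_isUniversal (v := ⟨none, hv⟩) ?_
          intro o ho
          simpa using fun h => ho (Subtype.ext h) }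
  have hw : D.width ≤ Nat.card V - I.card - 1 := by
    refine ciSup_le' ?_
    have hc : {u : V | u ∉ I}.ncard = Nat.card V - I.card := by
      have h := Set.ncard_add_ncard_compl (I : Set V)
      rw [Set.ncard_coe_finset] at h
      have : (I : Set V)ᶜ = {u : V | u ∉ I} := rfl
      rw [this] at h
      omega
    rintro (_ | i)
    · exact (congrArg (· - 1) hc).le
    · obtain ⟨u, hu, hadj⟩ := hnon (e i) (e i).2
      have hsub : {x | x = (e i : V) ∨ G.Adj (e i) x} ⊆
          insert (e i : V) ({u : V | u ∉ I} \ {u}) := by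
        rintro x (rfl | hx)
        · exact Set.mem_insert _ _
        · refine Set.mem_insert_of_mem _ ⟨fun hxI => hI (e i).2 hxI hx.ne hx, ?_⟩
          rintro rfl
          exact hadj hx
      have h1 := Set.ncard_le_ncard hsub
      have h2 := Set.ncard_insert_le (e i : V) ({u : V | u ∉ I} \ {u})
      have h3 := Set.ncard_sdiff_singleton_of_mem (a := u) (s := {u : V | u ∉ I}) hu
      change Set.ncard {x | x = (e i : V) ∨ G.Adj (e i) x} - 1 ≤ _
      omega
  have : treewidth G ≤ D.width := Nat.sInf_le ⟨_, D, rfl⟩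
  omega

/-! ### Lines meeting in a projective space -/

open Module

section Geometry

variable {F V : Type*} [Field F] [AddCommGroup V] [Module F V]

/-- The lines (two-dimensional subspaces) that meet every subspace in `S` nontrivially. -/
def transversals (S : Set (Submodule F V)) : Set (Submodule F V) :=
  {U | finrank F U = 2 ∧ ∀ s ∈ S, ¬ Disjoint U s}

lemma not_disjoint_self {U : Submodule F V} (hU : finrank F U = 2) : ¬ Disjoint U U := by
  rw [disjoint_self]
  rintro rfl
  simp at hU

section FiniteDimensional

variable [FiniteDimensional F V]

lemma one_le_finrank_inf {U W : Submodule F V} (h : ¬ Disjoint U W) :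
    1 ≤ finrank F ↥(U ⊓ W) := by
  rw [Nat.one_le_iff_ne_zero, Ne, Submodule.finrank_eq_zero, ← disjoint_iff]
  exact h

lemma finrank_inf_eq_one {U W : Submodule F V} (hU : finrank F U = 2) (hW : finrank F W = 2)
    (hne : U ≠ W) (h : ¬ Disjoint U W) : finrank F ↥(U ⊓ W) = 1 := by
  have h1 := one_le_finrank_inf h
  have h2 : finrank F ↥(U ⊓ W) < finrank F U := Submodule.finrank_lt_finrank_of_lt <|
    inf_lt_left.2 fun hle => hne (Submodule.eq_of_le_of_finrank_eq hle (hU.trans hW.symm))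
  omega

lemma le_of_not_disjoint_of_finrank_eq_one {P U : Submodule F V} (hP : finrank F P = 1)
    (h : ¬ Disjoint P U) : P ≤ U := by
  have h1 := one_le_finrank_inf h
  exact inf_eq_left.1 (Submodule.eq_of_le_of_finrank_le inf_le_left (by omega))

/-- A line that meets `x` and `y` in different points is spanned by them. -/
lemma eq_sup_inf_of_disjoint {c x y : Submodule F V} (hc : finrank F c = 2)
    (hx : ¬ Disjoint c x) (hy : ¬ Disjoint c y) (h : Disjoint (c ⊓ x) y) :
    c = (c ⊓ x) ⊔ (c ⊓ y) := by
  have h1 := one_le_finrank_inf hx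
  have h2 := one_le_finrank_inf hy
  have h3 := Submodule.finrank_sup_add_finrank_inf_eq (c ⊓ x) (c ⊓ y)
  have h4 : (c ⊓ x) ⊓ (c ⊓ y) = ⊥ := (h.mono_right inf_le_right).eq_bot
  rw [h4, finrank_bot] at h3
  exact (Submodule.eq_of_le_of_finrank_le (sup_le inf_le_left inf_le_left) (by omega)).symm

lemma le_sup_of_disjoint_inf {c x y : Submodule F V} (hc : finrank F c = 2)
    (hx : ¬ Disjoint c x) (hy : ¬ Disjoint c y) (h : Disjoint (c ⊓ x) y) : c ≤ x ⊔ y := by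
  rw [eq_sup_inf_of_disjoint hc hx hy h]
  exact sup_le_sup inf_le_right inf_le_right

lemma sup_eq_of_finrank_eq_one {P Q a : Submodule F V} (hP : finrank F P = 1)
    (hQ : finrank F Q = 1) (ha : finrank F a = 2) (hPa : P ≤ a) (hQa : Q ≤ a) (hne : P ≠ Q) :
    P ⊔ Q = a := by
  have hd : Disjoint P Q := by
    by_contra h
    exact hne (Submodule.eq_of_le_of_finrank_eq (le_of_not_disjoint_of_finrank_eq_one hP h)
      (hP.trans hQ.symm))
  have h3 := Submodule.finrank_sup_add_finrank_inf_eq P Q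
  rw [hd.eq_bot, finrank_bot] at h3
  exact Submodule.eq_of_le_of_finrank_le (sup_le hPa hQa) (by omega)

lemma finrank_sup_of_disjoint {U W : Submodule F V} (h : Disjoint U W) :
    finrank F ↥(U ⊔ W) = finrank F U + finrank F W := by
  have h3 := Submodule.finrank_sup_add_finrank_inf_eq U W
  rwa [h.eq_bot, finrank_bot, add_zero] at h3

/-- If three pairwise meeting lines `a`, `b`, `c` are not coplanar, then they are concurrent, and
so is every line that meets all three. -/
lemma inf_le_of_not_le_sup {a b c U : Submodule F V} (ha : finrank F a = 2) (hb : finrank F b = 2)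
    (hc : finrank F c = 2) (hU : finrank F U = 2) (hne : a ≠ b) (hab : ¬ Disjoint a b)
    (hca : ¬ Disjoint c a) (hcb : ¬ Disjoint c b) (hcle : ¬ c ≤ a ⊔ b)
    (hUa : ¬ Disjoint U a) (hUb : ¬ Disjoint U b) (hUc : ¬ Disjoint U c) : a ⊓ b ≤ U := by
  have hP := finrank_inf_eq_one ha hb hne hab
  have hPc : a ⊓ b ≤ c := by
    refine le_of_not_disjoint_of_finrank_eq_one hP fun h => hcle ?_
    refine le_sup_of_disjoint_inf hc hca hcb ?_
    rw [disjoint_iff, inf_assoc, inf_comm]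
    exact h.eq_bot
  refine le_of_not_disjoint_of_finrank_eq_one hP fun h => hUc ?_
  have hUle : U ≤ a ⊔ b := by
    refine le_sup_of_disjoint_inf hU hUa hUb ?_
    rw [disjoint_iff, inf_assoc, inf_comm]
    exact h.eq_bot
  have hlt : finrank F ↥(c ⊓ (a ⊔ b)) < finrank F c :=
    Submodule.finrank_lt_finrank_of_lt (inf_lt_left.2 hcle)
  have heq : a ⊓ b = c ⊓ (a ⊔ b) :=
    Submodule.eq_of_le_of_finrank_le (le_inf hPc (inf_le_left.trans le_sup_left)) (by omega)
  have hle : U ⊓ c ≤ a ⊓ b := heq ▸ le_inf inf_le_right (inf_le_left.trans hUle)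
  exact disjoint_iff_inf_le.2 ((le_inf hle inf_le_left).trans h.le_bot)

/-- If three pairwise meeting lines `a`, `b`, `c` are not concurrent, then they are coplanar, and
so is every line that meets all three. -/
lemma le_sup_of_not_inf_le {a b c U : Submodule F V} (ha : finrank F a = 2) (hb : finrank F b = 2)
    (hc : finrank F c = 2) (hU : finrank F U = 2) (hne : a ≠ b) (hab : ¬ Disjoint a b)
    (hca : ¬ Disjoint c a) (hcb : ¬ Disjoint c b) (hle : ¬ a ⊓ b ≤ c)
    (hUa : ¬ Disjoint U a) (hUb : ¬ Disjoint U b) (hUc : ¬ Disjoint U c) : U ≤ a ⊔ b := by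
  have hP := finrank_inf_eq_one ha hb hne hab
  have hPc : Disjoint (a ⊓ b) c := by
    by_contra h
    exact hle (le_of_not_disjoint_of_finrank_eq_one hP h)
  have hcle : c ≤ a ⊔ b := by
    refine le_sup_of_disjoint_inf hc hca hcb ?_
    rw [disjoint_iff, inf_assoc, inf_comm]
    exact hPc.eq_bot
  by_cases hPU : a ⊓ b ≤ U
  · by_cases hUa' : U = a
    · exact hUa' ▸ le_sup_left
    have heq : a ⊓ b = U ⊓ a := Submodule.eq_of_le_of_finrank_eq (le_inf hPU inf_le_left)
      (hP.trans (finrank_inf_eq_one hU ha hUa' hUa).symm)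
    exact (le_sup_of_disjoint_inf hU hUa hUc (heq ▸ hPc)).trans (sup_le le_sup_left hcle)
  · refine le_sup_of_disjoint_inf hU hUa hUb ?_
    rw [disjoint_iff, inf_assoc, inf_comm, ← disjoint_iff]
    by_contra h
    exact hPU (le_of_not_disjoint_of_finrank_eq_one hP h)

end FiniteDimensional

/-! ### Counting points and lines -/

section Counting

lemma ncard_points (W : Submodule F V) [Finite F] :
    {Q : Submodule F V | finrank F Q = 1 ∧ Q ≤ W}.ncard =
      ∑ i ∈ Finset.range (finrank F W), Nat.card F ^ i := by
  rw [← Projectivization.card_of_finrank F W rfl,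
    Nat.card_congr (Projectivization.equivSubmodule F W)]
  have himg : {Q : Submodule F V | finrank F Q = 1 ∧ Q ≤ W} =
      Submodule.map W.subtype '' {H : Submodule F W | finrank F H = 1} := by
    ext Q
    constructor
    · rintro ⟨h1, h2⟩
      have h3 : Submodule.map W.subtype (Submodule.comap W.subtype Q) = Q := by
        rw [Submodule.map_comap_subtype, inf_eq_right.2 h2]
      refine ⟨Submodule.comap W.subtype Q, ?_, h3⟩
      rw [← h1, ← h3, Submodule.finrank_map_subtype_eq, h3]
      rfl
    · rintro ⟨H, hH, rfl⟩
      exact ⟨by rw [Submodule.finrank_map_subtype_eq]; exact hH, Submodule.map_subtype_le _ _⟩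
  rw [himg, Set.ncard_image_of_injective _ (Submodule.map_injective_of_injective
    W.injective_subtype)]
  rfl

variable [Finite V]

/-- The lines through a point `P` in a subspace `W` correspond to the points of a complement of
`P` in `W`. -/
lemma ncard_lines_through [Finite F] {P W : Submodule F V} (hP : finrank F P = 1) (hPW : P ≤ W)
    {n : ℕ} (hW : finrank F W = n + 1) :
    {U : Submodule F V | finrank F U = 2 ∧ P ≤ U ∧ U ≤ W}.ncard =
      ∑ i ∈ Finset.range n, Nat.card F ^ i := by
  obtain ⟨C, hC⟩ := exists_isCompl P
  have hsup : P ⊔ C ⊓ W = W := by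
    rw [← sup_inf_assoc_of_le C hPW, hC.sup_eq_top, top_inf_eq]
  have hdis : Disjoint P (C ⊓ W) := hC.disjoint.mono_right inf_le_left
  have hn : finrank F ↥(C ⊓ W) = n := by
    have := finrank_sup_of_disjoint hdis
    rw [hsup] at this
    omega
  rw [← hn, ← ncard_points]
  symm
  refine Set.ncard_congr (fun Q _ => P ⊔ Q) ?_ ?_ ?_
  · rintro Q ⟨hQ, hQW⟩
    refine ⟨?_, le_sup_left, sup_le hPW (hQW.trans inf_le_right)⟩
    rw [finrank_sup_of_disjoint (hdis.mono_right hQW), hP, hQ]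
  · rintro Q Q' ⟨-, hQ⟩ ⟨-, hQ'⟩ h
    have key (R : Submodule F V) (hR : R ≤ C ⊓ W) : (P ⊔ R) ⊓ (C ⊓ W) = R := by
      rw [sup_comm, sup_inf_assoc_of_le P hR, hdis.eq_bot, sup_bot_eq]
    rw [← key Q hQ, ← key Q' hQ']
    exact congrArg (· ⊓ (C ⊓ W)) h
  · rintro U ⟨hU, hPU, hUW⟩
    have h1 : P ⊔ (C ⊓ W) ⊓ U = U := by
      rw [← sup_inf_assoc_of_le _ hPU, hsup, inf_eq_right.2 hUW]
    refine ⟨(C ⊓ W) ⊓ U, ⟨?_, inf_le_left⟩, h1⟩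
    have := finrank_sup_of_disjoint (hdis.mono_right (inf_le_left (b := U)))
    rw [h1] at this
    omega

/-- By duality, a plane has at most as many lines as points. -/
lemma ncard_lines_in_plane_le [Finite F] {W : Submodule F V} (hW : finrank F W = 3) :
    {U : Submodule F V | finrank F U = 2 ∧ U ≤ W}.ncard ≤
      Nat.card F ^ 2 + Nat.card F + 1 := by
  have : Finite (Dual F W) := Module.finite_of_finite F
  have h := ncard_points (⊤ : Submodule F (Dual F W))
  rw [finrank_top, Subspace.dual_finrank_eq, hW] at h
  have h' : ∑ i ∈ Finset.range 3, Nat.card F ^ i = Nat.card F ^ 2 + Nat.card F + 1 := by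
    simp [Finset.sum_range_succ]; ring
  rw [← h', ← h]
  refine Set.ncard_le_ncard_of_injOn
    (fun U => (Submodule.comap W.subtype U).dualAnnihilator) ?_ ?_
  · rintro U ⟨hU, hUW⟩
    refine ⟨?_, le_top⟩
    have h1 := Subspace.finrank_add_finrank_dualAnnihilator_eq (Submodule.comap W.subtype U)
    have h2 : finrank F ↥(Submodule.comap W.subtype U) = 2 := by
      rw [← hU]
      exact (Submodule.comapSubtypeEquivOfLe hUW).finrank_eq
    omega
  · rintro U ⟨-, hU⟩ U' ⟨-, hU'⟩ h
    have h1 := Subspace.dualAnnihilator_inj.1 h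
    rw [← inf_eq_right.2 hU, ← inf_eq_right.2 hU', ← Submodule.map_comap_subtype, h1,
      Submodule.map_comap_subtype]

end Counting

end Geometry

/-! ### Common transversals -/

/-- If a map into `t` has all fibres of size at most `k`, and at most one of them has more than one
element, then the domain has at most `#t - 1 + k` elements. -/
lemma Finset.card_add_one_le_of_unique_large_fiber {α β : Type*} [DecidableEq β] {s : Finset α}
    {t : Finset β} {f : α → β} {k : ℕ} (hf : ∀ x ∈ s, f x ∈ t) (hk : 1 ≤ k)
    (hle : ∀ y ∈ t, {x ∈ s | f x = y}.card ≤ k)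
    (huniq : ∀ y ∈ t, ∀ y' ∈ t, 1 < {x ∈ s | f x = y}.card → 1 < {x ∈ s | f x = y'}.card →
      y = y') : s.card + 1 ≤ t.card + k := by
  rw [Finset.card_eq_sum_card_fiberwise hf]
  by_cases h : ∃ y ∈ t, 1 < {x ∈ s | f x = y}.card
  · obtain ⟨y, hy, hy1⟩ := h
    rw [← Finset.add_sum_erase t _ hy]
    have h1 : ∑ x ∈ t.erase y, {a ∈ s | f a = x}.card ≤ ∑ x ∈ t.erase y, 1 := by
      refine Finset.sum_le_sum fun x hx => ?_
      rw [Finset.mem_erase] at hx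
      by_contra hlt
      exact hx.1 (huniq x hx.2 y hy (not_le.1 hlt) hy1)
    have h2 := Finset.card_erase_add_one hy
    have h3 := hle y hy
    simp only [Finset.sum_const, smul_eq_mul, mul_one] at h1
    omega
  · push Not at h
    have h1 : ∑ x ∈ t, {a ∈ s | f a = x}.card ≤ ∑ x ∈ t, 1 := Finset.sum_le_sum h
    simp only [Finset.sum_const, smul_eq_mul, mul_one] at h1
    omega

section Geometry

variable {F V : Type*} [Field F] [AddCommGroup V] [Module F V]

lemma mem_transversals_triple {a b c U : Submodule F V} : U ∈ transversals {a, b, c} ↔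
    finrank F U = 2 ∧ ¬ Disjoint U a ∧ ¬ Disjoint U b ∧ ¬ Disjoint U c := by
  simp [transversals]

variable [Finite V]

/-- Three lines `a`, `b`, `c`, of which `a` and `b` are skew, have at most `2 q + 1` common
transversals. Each point of `a` lies on at most one of them, except possibly for a single point,
which may lie on `q + 1`. -/
lemma ncard_transversals_triple_le [Finite F] {a b c : Submodule F V} (ha : finrank F a = 2)
    (hb : finrank F b = 2) (hc : finrank F c = 2) (hab : Disjoint a b) (hca : c ≠ a)
    (hcb : c ≠ b) : (transversals {a, b, c}).ncard ≤ 2 * Nat.card F + 1 := by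
  classical
  have hUa {U : Submodule F V} (hU : U ∈ transversals {a, b, c}) : finrank F ↥(U ⊓ a) = 1 := by
    rw [mem_transversals_triple] at hU
    refine finrank_inf_eq_one hU.1 ha ?_ hU.2.1
    rintro rfl
    exact hU.2.2.1 hab
  have hsub {U : Submodule F V} (hU : U ∈ transversals {a, b, c}) : U ≤ U ⊓ a ⊔ b := by
    rw [mem_transversals_triple] at hU
    conv_lhs => rw [eq_sup_inf_of_disjoint hU.1 hU.2.1 hU.2.2.1 (hab.mono_left inf_le_right)]
    exact sup_le_sup le_rfl inf_le_right
  have hPb {P : Submodule F V} (hP : finrank F P = 1) (hPa : P ≤ a) :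
      finrank F ↥(P ⊔ b) = 3 := by
    rw [finrank_sup_of_disjoint (hab.mono_left hPa), hP, hb]
  -- A point of `a` on two of the transversals is on `c`, or spans a plane through `c` with `b`.
  have hbad {U U' : Submodule F V} (hU : U ∈ transversals {a, b, c})
      (hU' : U' ∈ transversals {a, b, c}) (hne : U ≠ U') (heq : U ⊓ a = U' ⊓ a) :
      U ⊓ a ≤ c ∨ c ≤ U ⊓ a ⊔ b := by
    by_contra! hcon
    refine hcon.2 ?_
    have hU1 := mem_transversals_triple.1 hU
    have hU1' := mem_transversals_triple.1 hU'
    have hle : U ⊓ a ≤ U ⊓ U' := le_inf inf_le_left (heq ▸ inf_le_left)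
    have hmeet : ¬ Disjoint U U' := by
      intro h
      have := h.eq_bot ▸ hle
      exact hU1.2.1 (disjoint_iff_inf_le.2 this)
    have h1 : U ⊓ a = U ⊓ U' := Submodule.eq_of_le_of_finrank_eq hle
      ((hUa hU).trans (finrank_inf_eq_one hU1.1 hU1'.1 hne hmeet).symm)
    have h2 : Disjoint (c ⊓ U) U' := by
      rw [disjoint_iff, inf_assoc, ← h1, ← disjoint_iff]
      by_contra h
      exact hcon.1 (le_of_not_disjoint_of_finrank_eq_one (hUa hU) fun h' => h h'.symm)
    refine (le_sup_of_disjoint_inf hc (fun h => hU1.2.2.2 h.symm) (fun h => hU1'.2.2.2 h.symm)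
      h2).trans (sup_le (hsub hU) ?_)
    rw [heq]
    exact hsub hU'
  have hnot {P P' : Submodule F V} (hP : finrank F P = 1) (hPa : P ≤ a) (hP' : finrank F P' = 1)
      (hPa' : P' ≤ a) (hne : P ≠ P') : ¬ P' ≤ P ⊔ b := by
    intro h
    have h1 : a ⊔ b ≤ P ⊔ b := by
      rw [← sup_eq_of_finrank_eq_one hP hP' ha hPa hPa' hne]
      exact sup_le (sup_le le_sup_left h) le_sup_right
    have h2 := Submodule.finrank_mono h1
    rw [hPb hP hPa, finrank_sup_of_disjoint hab, ha, hb] at h2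
    omega
  have huniq {P P' : Submodule F V} (hP : finrank F P = 1) (hPa : P ≤ a) (hP' : finrank F P' = 1)
      (hPa' : P' ≤ a) (h : P ≤ c ∨ c ≤ P ⊔ b) (h' : P' ≤ c ∨ c ≤ P' ⊔ b) : P = P' := by
    by_contra hne
    rcases h with h | h <;> rcases h' with h' | h'
    · refine hca (Submodule.eq_of_le_of_finrank_eq ?_ (ha.trans hc.symm)).symm
      rw [← sup_eq_of_finrank_eq_one hP hP' ha hPa hPa' hne]
      exact sup_le h h'
    · exact hnot hP' hPa' hP hPa (Ne.symm hne) (h.trans h')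
    · exact hnot hP hPa hP' hPa' hne (h'.trans h)
    · have h3 : 3 ≤ finrank F ↥(c ⊔ b) := by
        have : finrank F b < finrank F ↥(c ⊔ b) := Submodule.finrank_lt_finrank_of_lt <|
          right_lt_sup.2 fun hle => hcb (Submodule.eq_of_le_of_finrank_eq hle (hc.trans hb.symm))
        omega
      have h4 : c ⊔ b = P ⊔ b := Submodule.eq_of_le_of_finrank_le (sup_le h le_sup_right)
        (by rw [hPb hP hPa]; exact h3)
      have h5 : c ⊔ b = P' ⊔ b := Submodule.eq_of_le_of_finrank_le (sup_le h' le_sup_right)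
        (by rw [hPb hP' hPa']; exact h3)
      exact hnot hP hPa hP' hPa' hne (h4 ▸ h5 ▸ le_sup_left)
  have hs := Set.toFinite (transversals {a, b, c})
  have ht := Set.toFinite {Q : Submodule F V | finrank F Q = 1 ∧ Q ≤ a}
  have htc : ht.toFinset.card = Nat.card F + 1 := by
    rw [← Set.ncard_eq_toFinset_card, ncard_points, ha]
    simp [Finset.sum_range_succ]; ring
  have key := Finset.card_add_one_le_of_unique_large_fiber (s := hs.toFinset) (t := ht.toFinset)
    (f := fun U => U ⊓ a) (k := Nat.card F + 1) ?_ (by omega) ?_ ?_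
  · rw [Set.ncard_eq_toFinset_card _ hs]
    omega
  · intro U hU
    rw [Set.Finite.mem_toFinset] at hU ⊢
    exact ⟨hUa hU, inf_le_right⟩
  · intro P hP
    rw [Set.Finite.mem_toFinset] at hP
    have h1 := ncard_lines_through hP.1 (le_sup_left (b := b)) (n := 2) (hPb hP.1 hP.2)
    have h2 : ∑ i ∈ Finset.range 2, Nat.card F ^ i = Nat.card F + 1 := by
      simp [Finset.sum_range_succ]; ring
    rw [← h2, ← h1, ← Set.ncard_coe_finset]
    refine Set.ncard_le_ncard fun U hU => ?_
    simp only [Finset.coe_filter, Set.Finite.mem_toFinset, Set.mem_ofPred_eq] at hU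
    obtain ⟨hU, rfl⟩ := hU
    exact ⟨(mem_transversals_triple.1 hU).1, inf_le_left, hsub hU⟩
  · intro P hP P' hP' h h'
    rw [Set.Finite.mem_toFinset] at hP hP'
    have hb' (Q : Submodule F V) (h : 1 < {x ∈ hs.toFinset | x ⊓ a = Q}.card) :
        Q ≤ c ∨ c ≤ Q ⊔ b := by
      obtain ⟨U, hU, U', hU', hne⟩ := Finset.one_lt_card.1 h
      simp only [Finset.mem_filter, Set.Finite.mem_toFinset] at hU hU'
      have := hbad hU.1 hU'.1 hne (hU.2.trans hU'.2.symm)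
      rwa [hU.2] at this
    exact huniq hP.1 hP.2 hP'.1 hP'.2 (hb' P h) (hb' P' h')

/-- Let `s` and `U` be common transversals of two skew lines `a` and `b`. If `U` meets `s`, then
they meet on `a` or on `b`: otherwise they would span `a` and `b`, hence a four-dimensional
space. -/
lemma inf_eq_inf_or_inf_eq_inf {a b s U : Submodule F V} (ha : finrank F a = 2)
    (hb : finrank F b = 2) (hs : finrank F s = 2) (hU : finrank F U = 2) (hab : Disjoint a b)
    (hsa : ¬ Disjoint s a) (hsb : ¬ Disjoint s b) (hUa : ¬ Disjoint U a) (hUb : ¬ Disjoint U b)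
    (hUs : ¬ Disjoint U s) : U ⊓ a = s ⊓ a ∨ U ⊓ b = s ⊓ b := by
  by_contra! h
  have hne {c d W : Submodule F V} (hcd : Disjoint c d) (hWd : ¬ Disjoint W d) : W ≠ c := by
    rintro rfl
    exact hWd hcd
  have h1 := sup_eq_of_finrank_eq_one (finrank_inf_eq_one hU ha (hne hab hUb) hUa)
    (finrank_inf_eq_one hs ha (hne hab hsb) hsa) ha inf_le_right inf_le_right h.1
  have h2 := sup_eq_of_finrank_eq_one (finrank_inf_eq_one hU hb (hne hab.symm hUa) hUb)
    (finrank_inf_eq_one hs hb (hne hab.symm hsa) hsb) hb inf_le_right inf_le_right h.2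
  have h3 : a ⊔ b ≤ U ⊔ s := by
    rw [← h1, ← h2]
    exact sup_le (sup_le_sup inf_le_left inf_le_left) (sup_le_sup inf_le_left inf_le_left)
  have h4 := Submodule.finrank_mono h3
  have h5 := Submodule.finrank_sup_add_finrank_inf_eq U s
  have h6 := one_le_finrank_inf hUs
  rw [finrank_sup_of_disjoint hab] at h4
  omega

/-- A skew quadrilateral `a`, `s`, `b`, `s'` has at most two transversals, its diagonals. -/
lemma ncard_transversals_quadruple_le {a b s s' : Submodule F V} (ha : finrank F a = 2)
    (hb : finrank F b = 2) (hs : finrank F s = 2) (hs' : finrank F s' = 2) (hab : Disjoint a b)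
    (hss : Disjoint s s') (hsa : ¬ Disjoint s a) (hsb : ¬ Disjoint s b) (hsa' : ¬ Disjoint s' a)
    (hsb' : ¬ Disjoint s' b) : (transversals {a, b, s, s'}).ncard ≤ 2 := by
  have hsub : transversals {a, b, s, s'} ⊆ {s ⊓ a ⊔ s' ⊓ b, s' ⊓ a ⊔ s ⊓ b} := by
    rintro U ⟨hU, hUm⟩
    have hUa : ¬ Disjoint U a := hUm a (by simp)
    have hUb : ¬ Disjoint U b := hUm b (by simp)
    have h := inf_eq_inf_or_inf_eq_inf ha hb hs hU hab hsa hsb hUa hUb (hUm s (by simp))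
    have h' := inf_eq_inf_or_inf_eq_inf ha hb hs' hU hab hsa' hsb' hUa hUb (hUm s' (by simp))
    have hne {c : Submodule F V} (hUc : ¬ Disjoint U c) (h : U ⊓ c = s ⊓ c)
        (h' : U ⊓ c = s' ⊓ c) : False := by
      have : U ⊓ c ≤ s ⊓ s' := le_inf (h ▸ inf_le_left) (h' ▸ inf_le_left)
      exact hUc (disjoint_iff_inf_le.2 (this.trans hss.le_bot))
    have heq := eq_sup_inf_of_disjoint hU hUa hUb (hab.mono_left inf_le_right)
    rcases h with h | h <;> rcases h' with h' | h'
    · exact (hne hUa h h').elim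
    · left; rw [heq, h, h']
    · right; rw [heq, h, h']; rfl
    · exact (hne hUb h h').elim
  exact (Set.ncard_le_ncard hsub).trans ((Set.ncard_insert_le _ _).trans (by simp))

/-! ### Pairwise meeting lines -/

variable [Finite F]

lemma ncard_pencil (hV : finrank F V = 4) {P : Submodule F V} (hP : finrank F P = 1) :
    {U : Submodule F V | finrank F U = 2 ∧ P ≤ U}.ncard = Nat.card F ^ 2 + Nat.card F + 1 := by
  have h := ncard_lines_through hP (le_top (a := P)) (n := 3) (by rw [finrank_top, hV])
  have h' : ∑ i ∈ Finset.range 3, Nat.card F ^ i = Nat.card F ^ 2 + Nat.card F + 1 := by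
    simp [Finset.sum_range_succ]; ring
  rw [← h', ← h]
  congr 1
  ext U
  simp

/-- Let `A` be a set of pairwise meeting lines containing two lines `a ≠ b`. If `A` has more than
`q² + q + 1` common transversals, the lines of `A` among them, then `A` is contained in the plane
pencil spanned by `a` and `b`. -/
lemma ncard_transversals_le_or (hV : finrank F V = 4) {A : Set (Submodule F V)}
    (hA : ∀ U ∈ A, finrank F U = 2)
    (hmeet : ∀ U ∈ A, ∀ W ∈ A, ¬ Disjoint U W) {a b : Submodule F V} (ha : a ∈ A) (hb : b ∈ A)
    (hne : a ≠ b) :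
    (transversals A).ncard ≤ Nat.card F ^ 2 + Nat.card F + 1 ∨
      ∀ c ∈ A, a ⊓ b ≤ c ∧ c ≤ a ⊔ b := by
  by_contra! hcon
  obtain ⟨hcard, c, hc, himp⟩ := hcon
  have hP := finrank_inf_eq_one (hA a ha) (hA b hb) hne (hmeet a ha b hb)
  refine absurd hcard (not_lt.2 ?_)
  by_cases hle : a ⊓ b ≤ c
  · have hsub : transversals A ⊆ {U | finrank F U = 2 ∧ a ⊓ b ≤ U} := fun U hU =>
      ⟨hU.1, inf_le_of_not_le_sup (hA a ha) (hA b hb) (hA c hc) hU.1 hne (hmeet a ha b hb)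
        (hmeet c hc a ha) (hmeet c hc b hb) (himp hle) (hU.2 a ha) (hU.2 b hb) (hU.2 c hc)⟩
    exact (Set.ncard_le_ncard hsub).trans (ncard_pencil hV hP).le
  · have h3 : finrank F ↥(a ⊔ b) = 3 := by
      have := Submodule.finrank_sup_add_finrank_inf_eq a b
      have := hA a ha
      have := hA b hb
      omega
    have hsub : transversals A ⊆ {U | finrank F U = 2 ∧ U ≤ a ⊔ b} := fun U hU =>
      ⟨hU.1, le_sup_of_not_inf_le (hA a ha) (hA b hb) (hA c hc) hU.1 hne (hmeet a ha b hb)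
        (hmeet c hc a ha) (hmeet c hc b hb) hle (hU.2 a ha) (hU.2 b hb) (hU.2 c hc)⟩
    exact (Set.ncard_le_ncard hsub).trans (ncard_lines_in_plane_le h3)

lemma ncard_plane_pencil {a b : Submodule F V} (ha : finrank F a = 2) (hb : finrank F b = 2)
    (hne : a ≠ b) (hab : ¬ Disjoint a b) :
    {U : Submodule F V | finrank F U = 2 ∧ a ⊓ b ≤ U ∧ U ≤ a ⊔ b}.ncard = Nat.card F + 1 := by
  have hP := finrank_inf_eq_one ha hb hne hab
  have h3 := Submodule.finrank_sup_add_finrank_inf_eq a b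
  rw [ncard_lines_through hP (inf_le_left.trans le_sup_left) (n := 2) (by omega)]
  simp [Finset.sum_range_succ]; ring

/-- A set of pairwise meeting lines has at most `q² + q + 1` elements. -/
lemma ncard_le_of_pairwise_meeting (hV : finrank F V = 4) {A : Set (Submodule F V)}
    (hA : ∀ U ∈ A, finrank F U = 2)
    (hmeet : ∀ U ∈ A, ∀ W ∈ A, ¬ Disjoint U W) :
    A.ncard ≤ Nat.card F ^ 2 + Nat.card F + 1 := by
  rcases le_or_gt A.ncard 1 with h | h
  · omega
  obtain ⟨a, ha, b, hb, hne⟩ := (Set.one_lt_ncard (Set.toFinite A)).1 h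
  rcases ncard_transversals_le_or hV hA hmeet ha hb hne with h | h
  · have hsub : A ⊆ transversals A := fun U hU => ⟨hA U hU, fun W hW => hmeet U hU W hW⟩
    exact (Set.ncard_le_ncard hsub).trans h
  · have h1 := ncard_plane_pencil (hA a ha) (hA b hb) hne (hmeet a ha b hb)
    have hsub : A ⊆ {U | finrank F U = 2 ∧ a ⊓ b ≤ U ∧ U ≤ a ⊔ b} := fun U hU => ⟨hA U hU, h U hU⟩
    have h2 := Set.ncard_le_ncard hsub
    rw [h1] at h2
    nlinarith

/-- A set `A` of at least two pairwise meeting lines, all skew to a line `v`, has together with its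
transversals that meet `v` at most `q² + q + 1` lines. In a plane pencil, `A` misses the line that
meets `v`. -/
lemma ncard_union_transversals_le (hV : finrank F V = 4) {A : Set (Submodule F V)}
    (hA : ∀ U ∈ A, finrank F U = 2)
    (hmeet : ∀ U ∈ A, ∀ W ∈ A, ¬ Disjoint U W) {a b v : Submodule F V} (ha : a ∈ A) (hb : b ∈ A)
    (hne : a ≠ b) (hv : finrank F v = 2) (hAv : ∀ U ∈ A, Disjoint v U) :
    (A ∪ transversals (insert v A)).ncard ≤ Nat.card F ^ 2 + Nat.card F + 1 := by
  have hq : 2 ≤ Nat.card F := Finite.one_lt_card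
  rcases ncard_transversals_le_or hV hA hmeet ha hb hne with h | h
  · refine (Set.ncard_le_ncard ?_).trans h
    rintro U (hU | hU)
    · exact ⟨hA U hU, fun W hW => hmeet U hU W hW⟩
    · exact ⟨hU.1, fun W hW => hU.2 W (Set.mem_insert_of_mem _ hW)⟩
  · have hP := finrank_inf_eq_one (hA a ha) (hA b hb) hne (hmeet a ha b hb)
    have h3 : finrank F ↥(a ⊔ b) = 3 := by
      have := Submodule.finrank_sup_add_finrank_inf_eq a b
      have := hA a ha
      have := hA b hb
      omega
    -- `U₀` is the line of the pencil through the point of `v` in the plane `a ⊔ b`.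
    obtain ⟨U₀, hU₀, hPU₀, hU₀le, hU₀v⟩ : ∃ U₀ : Submodule F V, finrank F U₀ = 2 ∧ a ⊓ b ≤ U₀ ∧
        U₀ ≤ a ⊔ b ∧ ¬ Disjoint v U₀ := by
      have h4 := Submodule.finrank_sup_add_finrank_inf_eq v (a ⊔ b)
      have h5 := Submodule.finrank_le (v ⊔ (a ⊔ b))
      have h6 : finrank F ↥(v ⊓ (a ⊔ b)) < finrank F v := by
        refine Submodule.finrank_lt_finrank_of_lt (inf_lt_left.2 fun hle => ?_)
        have h7 := Submodule.finrank_mono (sup_le hle (le_sup_left (a := a) (b := b)))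
        rw [finrank_sup_of_disjoint (hAv a ha), hA a ha] at h7
        omega
      have h8 : finrank F ↥(v ⊓ (a ⊔ b)) = 1 := by omega
      have h9 : Disjoint (a ⊓ b) (v ⊓ (a ⊔ b)) :=
        (hAv a ha).symm.mono inf_le_left inf_le_left
      refine ⟨a ⊓ b ⊔ v ⊓ (a ⊔ b), ?_, le_sup_left,
        sup_le (inf_le_left.trans le_sup_left) inf_le_right, fun hd => ?_⟩
      · rw [finrank_sup_of_disjoint h9, hP, h8]
      · have h10 : v ⊓ (a ⊔ b) ≤ ⊥ := hd inf_le_left le_sup_right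
        rw [le_bot_iff.1 h10, finrank_bot] at h8
        omega
    have hAcard : A.ncard ≤ Nat.card F := by
      have h4 : U₀ ∉ A := fun hU => hU₀v (hAv U₀ hU)
      have h5 : insert U₀ A ⊆ {U | finrank F U = 2 ∧ a ⊓ b ≤ U ∧ U ≤ a ⊔ b} := by
        rintro U (rfl | hU)
        · exact ⟨hU₀, hPU₀, hU₀le⟩
        · exact ⟨hA U hU, h U hU⟩
      have h6 := Set.ncard_le_ncard h5
      rw [ncard_plane_pencil (hA a ha) (hA b hb) hne (hmeet a ha b hb),
        Set.ncard_insert_of_notMem h4] at h6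
      omega
    have htrans : (transversals (insert v A)).ncard ≤ 2 * Nat.card F + 1 := by
      refine le_trans (Set.ncard_le_ncard fun U hU => ?_) (ncard_transversals_triple_le hv (hA a ha)
        (hA b hb) (hAv a ha) ?_ hne.symm)
      · exact mem_transversals_triple.2 ⟨hU.1, hU.2 v (Set.mem_insert _ _),
          hU.2 a (Set.mem_insert_of_mem _ ha), hU.2 b (Set.mem_insert_of_mem _ hb)⟩
      · rintro rfl
        exact not_disjoint_self hv (hAv b hb)
    have := Set.ncard_union_le A (transversals (insert v A))
    nlinarith

end Geometry

/-! ### The graph of lines -/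

section Kneser

variable {F : Type*} [Field F]

lemma qKneserGraph_adj_iff {U W : QKneserVertex F 4 2} :
    (qKneserGraph F 4 2 1).Adj U W ↔ Disjoint U.1 W.1 := by
  have h : finrank F ↥(U.1 ⊓ W.1) < 1 ↔ Disjoint U.1 W.1 := by
    rw [Nat.lt_one_iff, Submodule.finrank_eq_zero, disjoint_iff]
  refine ⟨fun hadj => h.1 hadj.2, fun hd => ⟨?_, h.2 hd⟩⟩
  rintro rfl
  exact not_disjoint_self U.2 hd

variable [Finite F]

lemma qKneserGraph_not_inducesMatching_univ :
    ¬ (qKneserGraph F 4 2 1).InducesMatching Set.univ := by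
  have hV : finrank F (Fin 4 → F) = 4 := by simp
  have hq : 2 ≤ Nat.card F := Finite.one_lt_card
  obtain ⟨x, hx⟩ := exists_ne (0 : Fin 4 → F)
  have hne : {U : Submodule F (Fin 4 → F) | finrank F U = 2 ∧ F ∙ x ≤ U}.Nonempty := by
    rw [← Set.ncard_pos, ncard_pencil hV (finrank_span_singleton hx)]
    omega
  obtain ⟨a, ha, -⟩ := hne
  have hlt : a < ⊤ := by
    refine lt_top_iff_ne_top.2 ?_
    rintro rfl
    rw [finrank_top] at ha
    omega
  obtain ⟨y, -, hy⟩ := SetLike.exists_of_lt hlt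
  have hy0 : y ≠ 0 := by
    rintro rfl
    exact hy a.zero_mem
  have hR : finrank F ↥(F ∙ y) = 1 := finrank_span_singleton hy0
  have hRa : Disjoint (F ∙ y) a := by
    by_contra h
    exact hy (le_of_not_disjoint_of_finrank_eq_one hR h (Submodule.mem_span_singleton_self y))
  -- Among the `q² + q + 1` lines through the point `F ∙ y`, only `q + 1` meet `a`.
  have h1 := ncard_pencil hV hR
  have h2 := ncard_lines_through hR (le_sup_left (b := a)) (n := 2)
    (by rw [finrank_sup_of_disjoint hRa, hR, ha])
  have h3 : ∑ i ∈ Finset.range 2, Nat.card F ^ i = Nat.card F + 1 := by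
    simp [Finset.sum_range_succ]; ring
  have h4 := Set.le_ncard_sdiff
    {U : Submodule F (Fin 4 → F) | finrank F U = 2 ∧ F ∙ y ≤ U ∧ U ≤ F ∙ y ⊔ a}
    {U : Submodule F (Fin 4 → F) | finrank F U = 2 ∧ F ∙ y ≤ U}
  have h5 : 1 < ({U : Submodule F (Fin 4 → F) | finrank F U = 2 ∧ F ∙ y ≤ U} \
      {U : Submodule F (Fin 4 → F) | finrank F U = 2 ∧ F ∙ y ≤ U ∧ U ≤ F ∙ y ⊔ a}).ncard := by
    rw [h1, h2, h3] at h4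
    have : 2 * 2 ≤ Nat.card F ^ 2 := by nlinarith
    omega
  obtain ⟨b, ⟨hb, hb'⟩, c, ⟨hc, hc'⟩, hbc⟩ := (Set.one_lt_ncard (Set.toFinite _)).1 h5
  have hdis {U : Submodule F (Fin 4 → F)} (hU : finrank F U = 2 ∧ F ∙ y ≤ U)
      (hU' : U ∉ {U : Submodule F (Fin 4 → F) | finrank F U = 2 ∧ F ∙ y ≤ U ∧ U ≤ F ∙ y ⊔ a}) :
      Disjoint a U := by
    by_contra h
    refine hU' ⟨hU.1, hU.2, le_sup_of_disjoint_inf hU.1 (fun hd => ?_) (fun hd => h hd.symm)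
      (hRa.mono_left inf_le_right)⟩
    have h6 : F ∙ y ≤ ⊥ := hd hU.2 le_rfl
    rw [le_bot_iff.1 h6, finrank_bot] at hR
    omega
  intro h
  exact hbc (congrArg Subtype.val (h ⟨a, ha⟩ trivial ⟨b, hb.1⟩ trivial ⟨c, hc.1⟩ trivial
    (qKneserGraph_adj_iff.2 (hdis hb hb')) (qKneserGraph_adj_iff.2 (hdis hc hc'))))

lemma ncard_le_ncard_of_forall_val_mem {S : Set (QKneserVertex F 4 2)}
    {R : Set (Submodule F (Fin 4 → F))} (h : ∀ x ∈ S, x.1 ∈ R) : S.ncard ≤ R.ncard := by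
  rw [← Set.ncard_image_of_injective S Subtype.val_injective]
  exact Set.ncard_le_ncard (Set.image_subset_iff.2 h)

/-- The case in which the component of `v` contains an edge `a b` that avoids `v`. Apart from `a`,
`b`, and possibly another edge `s s'` of the component, the separated lines are transversals of the
skew lines `a` and `b` and of a further line. -/
lemma ncard_separated_le_of_adj {Z : Set (QKneserVertex F 4 2)} {v : QKneserVertex F 4 2}
    (hv : v ∉ Z) (hZ : (qKneserGraph F 4 2 1).InducesMatching Z) {a b : QKneserVertex F 4 2}
    (ha : a ∈ (qKneserGraph F 4 2 1).attached Z v) (hb : b ∈ (qKneserGraph F 4 2 1).attached Z v)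
    (hab : (qKneserGraph F 4 2 1).Adj a b) (hva : (qKneserGraph F 4 2 1).Adj v a) :
    ((qKneserGraph F 4 2 1).separated Z v).ncard ≤ Nat.card F ^ 2 + Nat.card F + 1 := by
  have hq : 2 ≤ Nat.card F := Finite.one_lt_card
  have hq2 : 2 * Nat.card F ≤ Nat.card F ^ 2 := by nlinarith
  have hmeet {x y : QKneserVertex F 4 2} (h : ¬ (qKneserGraph F 4 2 1).Adj y x) :
      ¬ Disjoint x.1 y.1 := fun hd => h (qKneserGraph_adj_iff.2 hd.symm)
  -- A separated line `x` can be skew to a line `s` of the component only if `x` and `s` form one of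
  -- the edges of the matching.
  have hsep {x s : QKneserVertex F 4 2} (hx : x ∈ (qKneserGraph F 4 2 1).separated Z v)
      (hs : s ∈ (qKneserGraph F 4 2 1).attached Z v)
      (h : x ∈ (qKneserGraph F 4 2 1).attached Z v → ¬ (qKneserGraph F 4 2 1).Adj s x) :
      ¬ Disjoint x.1 s.1 := by
    rcases hx.2 with hx' | hx'
    · exact hmeet (h hx')
    · exact hmeet (hx'.2 s hs)
  have hsepa {x : QKneserVertex F 4 2} (hx : x ∈ (qKneserGraph F 4 2 1).separated Z v)
      (hxb : x ≠ b) : ¬ Disjoint x.1 a.1 :=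
    hsep hx ha fun hx' hadj => hxb (hZ a ha.1 x hx'.1 b hb.1 hadj hab)
  have hsepb {x : QKneserVertex F 4 2} (hx : x ∈ (qKneserGraph F 4 2 1).separated Z v)
      (hxa : x ≠ a) : ¬ Disjoint x.1 b.1 :=
    hsep hx hb fun hx' hadj => hxa (hZ b hb.1 x hx'.1 a ha.1 hadj hab.symm)
  have hval {x y : QKneserVertex F 4 2} (h : x ≠ y) : x.1 ≠ y.1 := Subtype.coe_injective.ne h
  have hdab := qKneserGraph_adj_iff.1 hab
  by_cases hs : ∃ s ∈ (qKneserGraph F 4 2 1).attached Z v, s ≠ a ∧ s ≠ b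
  · obtain ⟨s, hs, hsa, hsb⟩ := hs
    have hmem {x : QKneserVertex F 4 2} (hx : x ∈ (qKneserGraph F 4 2 1).attached Z v) :
        x ∈ (qKneserGraph F 4 2 1).separated Z v :=
      ⟨by rintro rfl; exact hv hx.1, .inl hx⟩
    by_cases hs' : ∃ s' ∈ (qKneserGraph F 4 2 1).attached Z v, (qKneserGraph F 4 2 1).Adj s s'
    · obtain ⟨s', hs', hss⟩ := hs'
      have hsa' : s' ≠ a := by
        rintro rfl
        exact hsb (hZ s' ha.1 s hs.1 b hb.1 hss.symm hab)
      have hsb' : s' ≠ b := by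
        rintro rfl
        exact hsa (hZ s' hb.1 s hs.1 a ha.1 hss.symm hab.symm)
      have h1 := ncard_transversals_quadruple_le a.2 b.2 s.2 s'.2 hdab
        (qKneserGraph_adj_iff.1 hss) (hsepa (hmem hs) hsb) (hsepb (hmem hs) hsa)
        (hsepa (hmem hs') hsb') (hsepb (hmem hs') hsa')
      have h2 : ((qKneserGraph F 4 2 1).separated Z v).ncard ≤
          (insert a.1 (insert b.1 (insert s.1 (insert s'.1
            (transversals {a.1, b.1, s.1, s'.1}))))).ncard := by
        refine ncard_le_ncard_of_forall_val_mem fun x hx => ?_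
        by_contra hcon
        simp only [Set.mem_insert_iff, not_or, ← Subtype.ext_iff] at hcon
        obtain ⟨hxa, hxb, hxs, hxs', hxt⟩ := hcon
        refine hxt ⟨x.2, ?_⟩
        simp only [Set.mem_insert_iff, Set.mem_singleton_iff, forall_eq_or_imp, forall_eq]
        exact ⟨hsepa hx hxb, hsepb hx hxa,
          hsep hx hs fun hx' hadj => hxs' (hZ s hs.1 x hx'.1 s' hs'.1 hadj hss),
          hsep hx hs' fun hx' hadj => hxs (hZ s' hs'.1 x hx'.1 s hs.1 hadj hss.symm)⟩
      have h3 := Set.ncard_insert_le a.1 (insert b.1 (insert s.1 (insert s'.1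
            (transversals {a.1, b.1, s.1, s'.1}))))
      have h4 := Set.ncard_insert_le b.1 (insert s.1 (insert s'.1
            (transversals {a.1, b.1, s.1, s'.1})))
      have h5 := Set.ncard_insert_le s.1 (insert s'.1 (transversals {a.1, b.1, s.1, s'.1}))
      have h6 := Set.ncard_insert_le s'.1 (transversals {a.1, b.1, s.1, s'.1})
      omega
    · have h1 := ncard_transversals_triple_le a.2 b.2 s.2 hdab (hval hsa) (hval hsb)
      have h2 : ((qKneserGraph F 4 2 1).separated Z v).ncard ≤
          (insert a.1 (insert b.1 (transversals {a.1, b.1, s.1}))).ncard := by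
        refine ncard_le_ncard_of_forall_val_mem fun x hx => ?_
        by_contra hcon
        simp only [Set.mem_insert_iff, not_or, ← Subtype.ext_iff] at hcon
        obtain ⟨hxa, hxb, hxt⟩ := hcon
        exact hxt (mem_transversals_triple.2 ⟨x.2, hsepa hx hxb, hsepb hx hxa,
          hsep hx hs fun hx' hadj => hs' ⟨x, hx', hadj⟩⟩)
      have h3 := Set.ncard_insert_le a.1 (insert b.1 (transversals {a.1, b.1, s.1}))
      have h4 := Set.ncard_insert_le b.1 (transversals {a.1, b.1, s.1})
      omega
  · push Not at hs
    have hbv : b ≠ v := by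
      rintro rfl
      exact hv hb.1
    have h1 := ncard_transversals_triple_le v.2 a.2 b.2 (qKneserGraph_adj_iff.1 hva) (hval hbv)
      (hval hab.ne')
    have h2 : ((qKneserGraph F 4 2 1).separated Z v).ncard ≤
        (insert a.1 (insert b.1 (transversals {v.1, a.1, b.1}))).ncard := by
      refine ncard_le_ncard_of_forall_val_mem fun x hx => ?_
      by_contra hcon
      simp only [Set.mem_insert_iff, not_or, ← Subtype.ext_iff] at hcon
      obtain ⟨hxa, hxb, hxt⟩ := hcon
      refine hxt (mem_transversals_triple.2 ⟨x.2, ?_, hsepa hx hxb, hsepb hx hxa⟩)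
      rcases hx.2 with hx' | hx'
      · exact absurd (hs x hx' hxa) hxb
      · exact hmeet hx'.1
    have h3 := Set.ncard_insert_le a.1 (insert b.1 (transversals {v.1, a.1, b.1}))
    have h4 := Set.ncard_insert_le b.1 (transversals {v.1, a.1, b.1})
    omega

/-- If `Z` induces a matching but `insert v Z` does not, then `separated Z v` has at most
`q² + q + 1` elements. Without an edge that avoids `v`, the component of `v` is a star. -/
lemma ncard_separated_le {Z : Set (QKneserVertex F 4 2)} {v : QKneserVertex F 4 2}
    (hv : v ∉ Z) (hZ : (qKneserGraph F 4 2 1).InducesMatching Z)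
    (hZv : ¬ (qKneserGraph F 4 2 1).InducesMatching (insert v Z)) :
    ((qKneserGraph F 4 2 1).separated Z v).ncard ≤ Nat.card F ^ 2 + Nat.card F + 1 := by
  have hV : finrank F (Fin 4 → F) = 4 := by simp
  by_cases hedge : ∃ a ∈ (qKneserGraph F 4 2 1).attached Z v,
      ∃ b ∈ (qKneserGraph F 4 2 1).attached Z v, (qKneserGraph F 4 2 1).Adj a b
  · obtain ⟨a, ha, b, hb, hab⟩ := hedge
    rcases ha.2 with h | ⟨w, hw, hvw, hwa⟩
    · exact ncard_separated_le_of_adj hv hZ ha hb hab h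
    · have hwb : w = b := hZ a ha.1 w hw b hb.1 hwa.symm hab
      exact ncard_separated_le_of_adj hv hZ hb ha hab.symm (hwb ▸ hvw)
  · push Not at hedge
    have hstar : ∀ u ∈ (qKneserGraph F 4 2 1).attached Z v, (qKneserGraph F 4 2 1).Adj v u := by
      rintro u hu
      rcases hu.2 with h | ⟨w, hw, hvw, hwu⟩
      · exact h
      · exact absurd hwu (hedge w ⟨hw, .inl hvw⟩ u hu)
    obtain ⟨a, ha, b, hb, hne⟩ : ∃ a ∈ (qKneserGraph F 4 2 1).attached Z v,
        ∃ b ∈ (qKneserGraph F 4 2 1).attached Z v, a ≠ b := by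
      unfold InducesMatching at hZv
      push Not at hZv
      obtain ⟨a, ha, b, hb, c, hc, hab, hac, hbc⟩ := hZv
      have key {x y : QKneserVertex F 4 2} (hx : x ∈ Z) (hy : y ∈ Z)
          (hvx : (qKneserGraph F 4 2 1).Adj v x) (hxy : (qKneserGraph F 4 2 1).Adj x y) : False :=
        hedge x ⟨hx, .inl hvx⟩ y ⟨hy, .inr ⟨x, hx, hvx, hxy⟩⟩ hxy
      rcases ha with rfl | ha
      · exact ⟨b, ⟨hb.resolve_left hab.ne', .inl hab⟩, c, ⟨hc.resolve_left hac.ne', .inl hac⟩, hbc⟩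
      · rcases hb with rfl | hb
        · exact (key ha (hc.resolve_left hbc.symm) hab.symm hac).elim
        · rcases hc with rfl | hc
          · exact (key ha hb hac.symm hab).elim
          · exact absurd (hZ a ha b hb c hc hab hac) hbc
    have h1 := ncard_union_transversals_le hV
      (A := Subtype.val '' (qKneserGraph F 4 2 1).attached Z v) (v := v.1)
      (by rintro _ ⟨u, -, rfl⟩; exact u.2)
      (by
        rintro _ ⟨u, hu, rfl⟩ _ ⟨w, hw, rfl⟩
        exact fun h => hedge u hu w hw (qKneserGraph_adj_iff.2 h))
      (Set.mem_image_of_mem _ ha) (Set.mem_image_of_mem _ hb) (Subtype.coe_injective.ne hne) v.2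
      (by
        rintro _ ⟨u, hu, rfl⟩
        exact qKneserGraph_adj_iff.1 (hstar u hu))
    refine (ncard_le_ncard_of_forall_val_mem fun x hx => ?_).trans h1
    rcases hx.2 with hx' | hx'
    · exact .inl (Set.mem_image_of_mem _ hx')
    · refine .inr ⟨x.2, ?_⟩
      rintro _ (rfl | ⟨u, hu, rfl⟩)
      · exact fun h => hx'.1 (qKneserGraph_adj_iff.2 h.symm)
      · exact fun h => hx'.2 u hu (qKneserGraph_adj_iff.2 h.symm)

/-- The lines through a point form an independent set of size `q² + q + 1`. Every line through the
point meets some line that does not contain it. -/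
lemma exists_isIndepSet_qKneserGraph : ∃ I : Finset (QKneserVertex F 4 2),
    (qKneserGraph F 4 2 1).IsIndepSet I ∧ I.card = Nat.card F ^ 2 + Nat.card F + 1 ∧
      ∀ v ∈ I, ∃ u ∉ I, ¬ (qKneserGraph F 4 2 1).Adj v u := by
  have hV : finrank F (Fin 4 → F) = 4 := by simp
  have hq : 2 ≤ Nat.card F := Finite.one_lt_card
  obtain ⟨x, hx⟩ := exists_ne (0 : Fin 4 → F)
  have hP : finrank F ↥(F ∙ x) = 1 := finrank_span_singleton hx
  have hmeet {P U W : Submodule F (Fin 4 → F)} (hP : finrank F P = 1) (hU : P ≤ U) (hW : P ≤ W) :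
      ¬ Disjoint U W := by
    intro h
    rw [le_bot_iff.1 (h hU hW), finrank_bot] at hP
    omega
  have hfin := Set.toFinite {U : QKneserVertex F 4 2 | F ∙ x ≤ U.1}
  refine ⟨hfin.toFinset, ?_, ?_, ?_⟩
  · intro U hU W hW _ hadj
    rw [SetLike.mem_coe, Set.Finite.mem_toFinset] at hU hW
    exact hmeet hP hU hW (qKneserGraph_adj_iff.1 hadj)
  · rw [← Set.ncard_eq_toFinset_card, ← ncard_pencil hV hP,
      ← Set.ncard_image_of_injective _ Subtype.val_injective]
    congr 1
    ext U
    constructor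
    · rintro ⟨W, hW, rfl⟩
      exact ⟨W.2, hW⟩
    · rintro ⟨hU, hPU⟩
      exact ⟨⟨U, hU⟩, hPU, rfl⟩
  · intro v hv
    rw [Set.Finite.mem_toFinset] at hv
    have h1 := ncard_points v.1
    have h2 : ∑ i ∈ Finset.range 2, Nat.card F ^ i = Nat.card F + 1 := by
      simp [Finset.sum_range_succ]; ring
    rw [v.2, h2] at h1
    obtain ⟨Q, ⟨hQ, hQv⟩, hQP⟩ := Set.exists_ne_of_one_lt_ncard (by rw [h1]; omega) (F ∙ x)
    obtain ⟨U, ⟨hU, hQU⟩, hUv⟩ := Set.exists_ne_of_one_lt_ncard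
      (s := {U : Submodule F (Fin 4 → F) | finrank F U = 2 ∧ Q ≤ U})
      (by rw [ncard_pencil hV hQ]; nlinarith) v.1
    refine ⟨⟨U, hU⟩, fun hmem => hUv ?_, fun hadj => ?_⟩
    · rw [Set.Finite.mem_toFinset] at hmem
      rw [← sup_eq_of_finrank_eq_one hQ hP hU hQU hmem hQP,
        ← sup_eq_of_finrank_eq_one hQ hP v.2 hQv hv hQP]
    · exact hmeet hQ hQv hQU (qKneserGraph_adj_iff.1 hadj)

lemma indepNum_qKneserGraph :
    (qKneserGraph F 4 2 1).indepNum = Nat.card F ^ 2 + Nat.card F + 1 := by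
  have hV : finrank F (Fin 4 → F) = 4 := by simp
  refine le_antisymm ?_ ?_
  · obtain ⟨s, hs, hcard⟩ := (qKneserGraph F 4 2 1).exists_isNIndepSet_indepNum
    rw [← hcard, ← Set.ncard_coe_finset, ← Set.ncard_image_of_injective _ Subtype.val_injective]
    refine ncard_le_of_pairwise_meeting hV ?_ ?_
    · rintro _ ⟨u, -, rfl⟩
      exact u.2
    · rintro _ ⟨u, hu, rfl⟩ _ ⟨w, hw, rfl⟩ h
      have hadj := qKneserGraph_adj_iff.2 h
      exact hs hu hw hadj.ne hadj
  · obtain ⟨I, hI, hcard, -⟩ := exists_isIndepSet_qKneserGraph (F := F)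
    exact hcard ▸ hI.card_le_indepNum

end Kneser

theorem theorem1p5 (q : ℕ) (hq : IsPrimePow q) (F : Type*) [Field F] [Finite F]
    (hF : Nat.card F = q) :
    (treewidth (qKneserGraph F 4 2 1) : ℤ)
        = (Nat.card (QKneserVertex F 4 2) : ℤ) - ((q : ℤ) ^ 2 + (q : ℤ) + 2) ∧
      (treewidth (qKneserGraph F 4 2 1) : ℤ)
        = (Nat.card (QKneserVertex F 4 2) : ℤ)
            - ((qKneserGraph F 4 2 1).indepNum : ℤ) - 1 := by
  obtain ⟨I, hI, hcard, hnon⟩ := exists_isIndepSet_qKneserGraph (F := F)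
  have hlt : I.card < Nat.card (QKneserVertex F 4 2) := by
    obtain ⟨v, hv⟩ : I.Nonempty := Finset.card_pos.1 (by omega)
    obtain ⟨u, hu, -⟩ := hnon v hv
    rw [← Set.ncard_coe_finset, ← Set.ncard_univ]
    exact Set.ncard_lt_ncard (Set.ssubset_univ_iff.2 fun h => hu (by
      rw [← Finset.mem_coe, h]; trivial))
  have hupper := hI.treewidth_add_card_add_one_le hlt hnon
  obtain ⟨ι, D, hD⟩ := exists_width_eq_treewidth (qKneserGraph F 4 2 1)
  have hlower := D.card_le_width_add qKneserGraph_not_inducesMatching_univ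
    (k := Nat.card F ^ 2 + Nat.card F + 1) fun Z v hv hZ hZv => ncard_separated_le hv hZ hZv
  rw [hD] at hlower
  rw [hcard] at hupper
  rw [indepNum_qKneserGraph]
  subst hF
  have h : (treewidth (qKneserGraph F 4 2 1) : ℤ) + (Nat.card F ^ 2 + Nat.card F + 1 + 1) =
      Nat.card (QKneserVertex F 4 2) := by
    exact_mod_cast (by omega : treewidth (qKneserGraph F 4 2 1) +
      (Nat.card F ^ 2 + Nat.card F + 1 + 1) = Nat.card (QKneserVertex F 4 2))
  push_cast
  constructor <;> linarith
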